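/- **Setting.** Let $\mathbf C$ be a *topological category*: a category with finite limits and a faithful forgetful functor $X\mapsto |X|$ to $\mathbf{Set}$ which has a fully faithful left adjoint $\mathbf F$ such that $\mathbf F$ commutes with finite limits, and such that for every discrete object $D$ and all objects $X,Y$ the natural map $\mathrm{Hom}_{\mathbf C}(D\times X,Y)\to \mathrm{Map}(|D|,\mathrm{Hom}_{\mathbf C}(X,Y))$, $f\mapsto (d\mapsto f(d,-))$, is bijective. Here $D$ is *discrete* if $\mathrm{Hom}_{\mathbf C}(D,Y)\to\mathrm{Map}(|D|,|Y|)$ is bijective for all $Y$. Write $\bullet$ for a one-point set. For a monoid object $M$ of $\mathbf C$, a *rigidified $M$-module* is an abelian group $A$ with an action of the monoid $|M|$ by additive endomorphisms, together with subgroups $h_A(X)\subseteq \mathrm{Map}(|X|,A)$, for all objects $X$ of $\mathbf C$, which are stable under precomposition with morphisms of $\mathbf C$ and satisfy $h_A(\mathbf F\bullet)=\mathrm{Map}(|\mathbf F\bullet|,A)=A$ and, for every $f\in h_A(X)$, $\big((m,x)\mapsto m\cdot f(x)\big)\in h_A(M\times X)$. A discrete object $D$ is *$A$-pliant* if for all $X$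 a map $f:|D|\times|X|\to A$ lies in $h_A(D\times X)$ if and only if $f(d,-)\in h_A(X)$ for all $d\in |D|$. For $n\ge 0$ let $C^n(M,A)$ be the group of all $f\in h_A(M^n)$ with $f(x_1,\dots,x_n)=0$ whenever some $x_i=1$. With the differential $$\partial f(x_1,\dots,x_{n+1})=x_1 f(x_2,\dots,x_{n+1})+\sum_{i=1}^n(-1)^i f(\dots,x_ix_{i+1},\dots)+(-1)^{n+1}f(x_1,\dots,x_n)$$ this is a cochain complex $C^\bullet(M,A)$ of abelian groups, placed in degrees $n\ge0$. **Theorem.** Let $\mathbf C$ be a topological category, $G$ a group object and $D$ a discrete monoid object in $\mathbf C$. Let $H\le G$ be a subgroup object for which there is a morphism $r:G\to H$ in $\mathbf C$ with $r(1)=1$ and $r(hg)=h\,r(g)$ for all $h\in |H|$, $g\in |G|$. Let $A$ be a rigidified $D\times H$-module such that $D$ is $A$-pliant. Let $\mathrm{Ind}_G^H(A)$ be the rigidified $D\times G$-module with underlying group $$\{\varphi\in h_A(G)\;:\;\varphi(hg)=h\,\varphi(g)\text{ for all } h\in |H|,\ g\in |G|\},$$ action $((d,g)\varphi)(\sigma)=d\,\varphi(\sigma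 g)$, and rigidification $$h_{\mathrm{Ind}_G^H(A)}(X)=\{f\in h_A(X\times G)\;:\; f(x,hg)=h\,f(x,g)\text{ for all } x\in |X|,\ h\in |H|,\ g\in |G|\}.$$ Then $$C^\bullet(D\times G,\mathrm{Ind}_G^H(A))\;\cong\; C^\bullet(D\times H,A)$$ in the derived category of abelian groups. -/

import Mathlib

open CategoryTheory Limits MonoidalCategory CartesianMonoidalCategory
open scoped MonObj

universe u v w t

noncomputable section

/-! ### Topological categories -/

/-- A category admitting discrete objects: a concrete category (finite limits are assumed through
the class `HasFiniteLimits`), whose forgetful functor has a fully faithful left adjoint `disc`. -/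
structure DiscreteObjectsData (C : Type u) [Category.{v} C] [HasFiniteLimits C] where
  /-- the forgetful functor -/
  forget : C ⥤ Type w
  forget_faithful : forget.Faithful
  /-- the discrete object on a set -/
  disc : Type w ⥤ C
  adj : disc ⊣ forget
  disc_full : disc.Full
  disc_faithful : disc.Faithful

namespace DiscreteObjectsData

variable {C : Type u} [Category.{v} C] [HasFiniteLimits C] (T : DiscreteObjectsData.{u, v, w} C)

/-- The underlying set of an object. -/
def El (X : C) : Type w := T.forget.obj X

/-- The underlying map of a morphism. -/
def map {X Y : C} (f : X ⟶ Y) : T.El X → T.El Y := ConcreteCategory.hom (T.forget.map f)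

/-- `D` is discrete if every map of sets out of `D` lifts uniquely to a morphism. -/
def IsDiscrete (D : C) : Prop :=
  ∀ Y : C, Function.Bijective (fun f : D ⟶ Y => T.map f)

/-- The discrete object on a singleton. -/
abbrev pt : C := T.disc.obj PUnit.{w + 1}

/-- Elements of `X` are the same as morphisms from the discrete singleton to `X`. -/
def point (X : C) : T.El X ≃ (T.pt ⟶ X) where
  toFun x := (T.adj.homEquiv _ _).symm (TypeCat.ofHom fun _ => x)
  invFun f := (ConcreteCategory.hom (T.adj.homEquiv _ _ f)) PUnit.unit
  left_inv x := by
    simp only [Equiv.apply_symm_apply]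
    rfl
  right_inv f := by
    rw [Equiv.symm_apply_eq]
    ext ⟨⟩
    rfl

/-- The constant morphism `X ⟶ D` with value `d`. -/
def const [PreservesFiniteLimits T.disc] (X : C) {D : C} (d : T.El D) : X ⟶ D :=
  (IsTerminal.isTerminalObj T.disc PUnit.{w + 1} Types.isTerminalPUnit).from X ≫ T.point D d

end DiscreteObjectsData

/-- A topological category: a category admitting discrete objects, such that `disc` commutes with
finite limits, and such that for discrete `D` the natural map
`Hom (D × X, Y) → Map (D, Hom (X, Y))`, `f ↦ (d ↦ f (d, -))`, is bijective. -/
structure TopologicalCategory (C : Type u) [Category.{v} C] [HasFiniteLimits C]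
    [CartesianMonoidalCategory C] extends DiscreteObjectsData.{u, v, w} C where
  disc_preservesFiniteLimits : PreservesFiniteLimits disc
  curry_bijective : ∀ D X Y : C, toDiscreteObjectsData.IsDiscrete D →
    Function.Bijective (fun (f : D ⊗ X ⟶ Y) (d : toDiscreteObjectsData.El D) =>
      lift (toDiscreteObjectsData.const X d) (𝟙 X) ≫ f)

namespace TopologicalCategory

variable {C : Type u} [Category.{v} C] [HasFiniteLimits C] [CartesianMonoidalCategory C]
  (T : TopologicalCategory.{u, v, w} C)

lemma map_id {X : C} (x : T.El X) : T.map (𝟙 X) x = x := by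
  simp only [DiscreteObjectsData.map, CategoryTheory.Functor.map_id]
  rfl

lemma map_comp {X Y Z : C} (f : X ⟶ Y) (g : Y ⟶ Z) (x : T.El X) :
    T.map (f ≫ g) x = T.map g (T.map f x) := by
  simp only [DiscreteObjectsData.map, CategoryTheory.Functor.map_comp]
  rfl

lemma point_map {X Y : C} (f : X ⟶ Y) (x : T.El X) :
    T.point Y (T.map f x) = T.point X x ≫ f := by
  have h := T.adj.homEquiv_naturality_right_symm (TypeCat.ofHom fun _ : PUnit.{w + 1} => x) f
  exact h

/-- The monoid structure on the underlying set of a monoid object. -/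
instance elMonoid (G : C) [MonObj G] : Monoid (T.El G) := (T.point G).monoid

lemma point_mul {G : C} [MonObj G] (a b : T.El G) :
    T.point G (a * b) = T.point G a * T.point G b :=
  (T.point G).apply_symm_apply _

lemma point_one {G : C} [MonObj G] : T.point G 1 = 1 :=
  (T.point G).apply_symm_apply _

/-- The product on the underlying set is the underlying map of the multiplication morphism. -/
lemma map_mul {G : C} [MonObj G] (p : T.El (G ⊗ G)) :
    T.map μ p = T.map (fst G G) p * T.map (snd G G) p := by
  apply (T.point G).injective
  rw [point_mul, point_map, point_map, point_map, Hom.mul_def, ← comp_lift, lift_fst_snd,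
    Category.comp_id]

lemma map_lift_mul {X G : C} [MonObj G] (f g : X ⟶ G) (x : T.El X) :
    T.map (lift f g ≫ μ) x = T.map f x * T.map g x := by
  rw [map_comp, map_mul, ← map_comp, ← map_comp, lift_fst, lift_snd]

lemma map_hom_mul {G H : C} [MonObj G] [MonObj H] (f : G ⟶ H) [IsMonHom f] (a b : T.El G) :
    T.map f (a * b) = T.map f a * T.map f b := by
  apply (T.point H).injective
  rw [point_mul, point_map, point_map, point_map, point_mul, MonObj.mul_comp]

lemma map_hom_one {G H : C} [MonObj G] [MonObj H] (f : G ⟶ H) [IsMonHom f] :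
    T.map f (1 : T.El G) = 1 := by
  apply (T.point H).injective
  rw [point_one, point_map, point_one, MonObj.one_comp]

lemma map_toUnit_one {X G : C} [MonObj G] (x : T.El X) : T.map (toUnit X ≫ η[G]) x = 1 := by
  apply (T.point G).injective
  rw [point_map, point_one, Hom.one_def, ← Category.assoc]
  congr 1
  exact toUnit_unique _ _

/-- The element `(x, y)` of a product. -/
def pair {X Y : C} (x : T.El X) (y : T.El Y) : T.El (X ⊗ Y) :=
  (T.point _).symm (lift (T.point X x) (T.point Y y))

@[simp] lemma fst_pair {X Y : C} (x : T.El X) (y : T.El Y) : T.map (fst X Y) (T.pair x y) = x := by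
  apply (T.point X).injective
  simp [point_map, pair]

@[simp] lemma snd_pair {X Y : C} (x : T.El X) (y : T.El Y) : T.map (snd X Y) (T.pair x y) = y := by
  apply (T.point Y).injective
  simp [point_map, pair]

lemma ext_prod {X Y : C} {p q : T.El (X ⊗ Y)} (h₁ : T.map (fst X Y) p = T.map (fst X Y) q)
    (h₂ : T.map (snd X Y) p = T.map (snd X Y) q) : p = q := by
  apply (T.point _).injective
  apply CartesianMonoidalCategory.hom_ext
  · rw [← point_map, ← point_map, h₁]
  · rw [← point_map, ← point_map, h₂]

lemma pair_mul_pair [BraidedCategory C] {D H : C} [MonObj D] [MonObj H] (a c : T.El D)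
    (b d : T.El H) : T.pair a b * T.pair c d = T.pair (a * c) (b * d) := by
  apply T.ext_prod <;> simp [map_hom_mul]

lemma pair_one_one [BraidedCategory C] {D H : C} [MonObj D] [MonObj H] :
    T.pair (1 : T.El D) (1 : T.El H) = 1 := by
  apply T.ext_prod <;> simp [map_hom_one]

/-- The element of the discrete singleton. -/
def ptElt : T.El T.pt := (T.point T.pt).symm (𝟙 _)

lemma pt_subsingleton (a b : T.El T.pt) : a = b := by
  have := T.disc_preservesFiniteLimits
  apply (T.point T.pt).injective
  exact (IsTerminal.isTerminalObj T.disc PUnit.{w + 1} Types.isTerminalPUnit).hom_ext _ _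

lemma map_const [PreservesFiniteLimits T.disc] {X D : C} (d : T.El D) (x : T.El X) :
    T.map (T.const X d) x = d := by
  apply (T.point D).injective
  rw [point_map, DiscreteObjectsData.const, ← Category.assoc,
    (IsTerminal.isTerminalObj T.disc PUnit.{w + 1} Types.isTerminalPUnit).hom_ext
      (T.point X x ≫ _) (𝟙 _), Category.id_comp]

/-! ### Rigidified sets and modules -/

/-- A set `Y` with rigidification: a subfunctor `X ↦ maps X` of `X ↦ Map (X, Y)` which contains
every map from the discrete singleton to `Y`. -/
structure RigidSet (Y : Type w) where
  maps : ∀ X : C, Set (T.El X → Y)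
  comp_mem : ∀ {X X' : C} (φ : X ⟶ X') {f : T.El X' → Y}, f ∈ maps X' → f ∘ T.map φ ∈ maps X
  pt_mem : ∀ f : T.El T.pt → Y, f ∈ maps T.pt

/-- `D` is `Y`-pliant: a map `D × X → Y` belongs to the rigidification if and only if each of its
restrictions to `{d} × X` does. -/
def RigidSet.IsPliant {T : TopologicalCategory.{u, v, w} C} {Y : Type w} (h : T.RigidSet Y)
    (D : C) : Prop :=
  ∀ (X : C) (f : T.El D → T.El X → Y),
    (fun p : T.El (D ⊗ X) => f (T.map (fst D X) p) (T.map (snd D X) p)) ∈ h.maps (D ⊗ X) ↔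
      ∀ d, f d ∈ h.maps X

/-- A `G`-module with rigidification, for a monoid object `G`. -/
structure RigidModule (G : C) [MonObj G] where
  carrier : Type w
  [addCommGroup : AddCommGroup carrier]
  [action : DistribMulAction (T.El G) carrier]
  rig : T.RigidSet carrier
  zero_mem : ∀ X : C, 0 ∈ rig.maps X
  add_mem : ∀ {X : C} {f g : T.El X → carrier},
    f ∈ rig.maps X → g ∈ rig.maps X → f + g ∈ rig.maps X
  neg_mem : ∀ {X : C} {f : T.El X → carrier}, f ∈ rig.maps X → -f ∈ rig.maps X
  smul_mem : ∀ {X : C} {f : T.El X → carrier}, f ∈ rig.maps X →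
    (fun p : T.El (G ⊗ X) => T.map (fst G X) p • f (T.map (snd G X) p)) ∈ rig.maps (G ⊗ X)

attribute [instance] RigidModule.addCommGroup RigidModule.action

/-! ### Cochains -/

section Cochains

/-- The bar differential, on all maps `Mⁿ → A`. -/
def barD {M A : Type w} [Monoid M] [AddCommGroup A] [DistribMulAction M A] (n : ℕ)
    (f : (Fin n → M) → A) (x : Fin (n + 1) → M) : A :=
  x 0 • f (fun i => x i.succ) +
    ∑ j : Fin (n + 1), (-1 : ℤ) ^ ((j : ℕ) + 1) • f (Fin.contractNth j (· * ·) x)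

/-- The coordinates of an element of the `n`-fold power of `G`. -/
def coords (T : TopologicalCategory.{u, v, w} C) (G : C) (n : ℕ)
    (p : T.El (∏ᶜ fun _ : Fin n => G)) : Fin n → T.El G :=
  fun i => T.map (Pi.π (fun _ : Fin n => G) i) p

variable {T}

lemma coords_lift {G : C} {n : ℕ} {X : C} (t : Fin n → (X ⟶ G)) (p : T.El X) :
    coords T G n (T.map (Pi.lift t) p) = fun k => T.map (t k) p := by
  ext k
  rw [coords, ← map_comp, Pi.lift_π]

variable {G : C} [MonObj G] (A : T.RigidModule G)

/-- The inhomogeneous cochains `Xⁿ(G, A)`, as maps `Gⁿ → A`. -/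
def cochains (n : ℕ) : AddSubgroup ((Fin n → T.El G) → A.carrier) where
  carrier := {f | f ∘ coords T G n ∈ A.rig.maps (∏ᶜ fun _ : Fin n => G)}
  zero_mem' := A.zero_mem _
  add_mem' := A.add_mem
  neg_mem' := A.neg_mem

/-- The normalised cochains `Cⁿ(G, A)`. -/
def normCochains (n : ℕ) : AddSubgroup ((Fin n → T.El G) → A.carrier) where
  carrier := {f | f ∈ cochains A n ∧ ∀ x : Fin n → T.El G, (∃ i, x i = 1) → f x = 0}
  zero_mem' := ⟨zero_mem _, fun _ _ => rfl⟩
  add_mem' := fun hf hg => ⟨add_mem hf.1 hg.1, fun x hx => by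
    rw [Pi.add_apply, hf.2 x hx, hg.2 x hx, add_zero]⟩
  neg_mem' := fun hf => ⟨neg_mem hf.1, fun x hx => by rw [Pi.neg_apply, hf.2 x hx, neg_zero]⟩

lemma contractNth_contractNth {M : Type w} [Monoid M] {n : ℕ} (x : Fin (n + 2) → M)
    (i j : Fin (n + 1)) (hij : i ≤ j) :
    Fin.contractNth i (· * ·) (Fin.contractNth j.succ (· * ·) x) =
      Fin.contractNth j (· * ·) (Fin.contractNth i.castSucc (· * ·) x) := by
  have hij' : (i : ℕ) ≤ j := hij
  ext k
  simp only [Fin.contractNth, Fin.val_succ, Fin.val_castSucc, Fin.succ_castSucc]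
  split_ifs <;> first | rfl | (exfalso; omega) | exact (mul_assoc _ _ _).symm

/-- An auxiliary extension of a cochain by one further variable. -/
def extendLeft {M A : Type w} [Monoid M] [AddCommGroup A] [DistribMulAction M A] {n : ℕ}
    (f : (Fin n → M) → A) (y : Fin (n + 1) → M) : A :=
  y 0 • f (fun i => y i.succ)

lemma extendLeft_barD {M A : Type w} [Monoid M] [AddCommGroup A] [DistribMulAction M A] {n : ℕ}
    (f : (Fin n → M) → A) (y : Fin (n + 2) → M) :
    extendLeft (barD n f) y =
      ∑ j : Fin (n + 2), (-1 : ℤ) ^ (j : ℕ) • extendLeft f (Fin.contractNth j (· * ·) y) := by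
  rw [Fin.sum_univ_succ]
  simp only [extendLeft, barD, smul_add, Finset.smul_sum]
  congr 1
  · rw [smul_smul, Fin.val_zero, pow_zero, one_smul]
    rfl
  · refine Finset.sum_congr rfl fun j _ => ?_
    rw [smul_comm, Fin.val_succ]
    congr 2
    congr 1
    ext k
    simp only [Fin.contractNth, Fin.val_succ, Fin.succ_castSucc, Nat.add_lt_add_iff_right,
      Nat.add_right_cancel_iff]

lemma barD_eq_extendLeft {M A : Type w} [Monoid M] [AddCommGroup A] [DistribMulAction M A] {n : ℕ}
    (f : (Fin n → M) → A) (x : Fin n → M) :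
    f x = extendLeft f (Fin.cons 1 x) := by
  simp [extendLeft]

lemma barD_barD {M A : Type w} [Monoid M] [AddCommGroup A] [DistribMulAction M A] (n : ℕ)
    (f : (Fin n → M) → A) : barD (n + 1) (barD n f) = 0 := by
  ext x
  rw [barD_eq_extendLeft (barD (n + 1) (barD n f)), extendLeft_barD]
  set y : Fin (n + 3) → M := Fin.cons 1 x
  simp only [extendLeft_barD, Finset.smul_sum, smul_smul, ← pow_add, Pi.zero_apply]
  rw [← Finset.sum_product', Finset.univ_product_univ]
  let S : Finset (Fin (n + 3) × Fin (n + 2)) := {p | (p.1 : ℕ) ≤ (p.2 : ℕ)}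
  rw [← Finset.sum_add_sum_compl S, ← eq_neg_iff_add_eq_zero, ← Finset.sum_neg_distrib]
  refine Finset.sum_bij
    (fun p hp => (p.2.succ, p.1.castLT (lt_of_le_of_lt (Finset.mem_filter.mp hp).2 p.2.2)))
    ?_ ?_ ?_ ?_
  · rintro ⟨a, b⟩ hp
    simp only [S, Finset.compl_filter, Finset.mem_filter_univ, Fin.val_succ, Fin.val_castLT] at hp ⊢
    omega
  · rintro ⟨a, b⟩ hp ⟨a', b'⟩ hp' h
    simp only [Prod.mk.injEq, Fin.ext_iff, Fin.val_succ, Fin.val_castLT] at h ⊢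
    omega
  · rintro ⟨a, b⟩ hp
    simp only [S, Finset.compl_filter, Finset.mem_filter_univ, not_le] at hp
    refine ⟨(b.castSucc, ⟨(a : ℕ) - 1, by omega⟩), ?_, ?_⟩
    · simp only [S, Finset.mem_filter_univ, Fin.val_castSucc]
      omega
    · refine Prod.ext (Fin.ext ?_) (Fin.ext ?_)
      · change (a : ℕ) - 1 + 1 = a
        omega
      · rfl
  · rintro ⟨a, b⟩ hp
    simp only [S, Finset.mem_filter_univ] at hp
    have ha : a = (a.castLT (lt_of_le_of_lt hp b.2)).castSucc := rfl
    simp only [Fin.val_succ, Fin.val_castLT]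
    rw [contractNth_contractNth y _ b (show a.castLT _ ≤ b from hp), ← ha, ← neg_smul]
    congr 1
    ring

lemma barD_eq_zero {M A : Type w} [Monoid M] [AddCommGroup A] [DistribMulAction M A] {n : ℕ}
    (f : (Fin n → M) → A) (hf : ∀ x : Fin n → M, (∃ i, x i = 1) → f x = 0)
    (x : Fin (n + 1) → M) (hx : ∃ i, x i = 1) : barD n f x = 0 := by
  obtain ⟨i, hi⟩ := hx
  rw [barD_eq_extendLeft (barD n f), extendLeft_barD]
  set y : Fin (n + 2) → M := Fin.cons 1 x with hy
  have hyi : y i.succ = 1 := by rw [hy, Fin.cons_succ, hi]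
  have h0 : ∀ z : Fin (n + 1) → M, (∃ k : Fin n, z k.succ = 1) → extendLeft f z = 0 :=
    fun z hz => by rw [extendLeft, hf _ hz, smul_zero]
  rw [Fintype.sum_eq_add i.castSucc i.succ (by simp [Fin.ext_iff])]
  · have : Fin.contractNth i.castSucc (· * ·) y = Fin.contractNth i.succ (· * ·) y := by
      ext k
      simp only [Fin.contractNth, Fin.val_succ, Fin.val_castSucc]
      rcases lt_trichotomy (k : ℕ) i with h | h | h
      · rw [if_pos h, if_pos (by omega)]
      · obtain rfl : k = i := Fin.ext h
        rw [if_neg (lt_irrefl _), if_pos rfl, if_pos (Nat.lt_succ_self _), hyi, mul_one]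
      · rw [if_neg (by omega), if_neg (by omega), if_neg (by omega)]
        split_ifs with h'
        · have : k.castSucc = i.succ := Fin.ext h'
          rw [this, hyi, one_mul]
        · rfl
    rw [this, Fin.val_succ, Fin.val_castSucc, pow_succ, mul_neg_one, neg_smul, add_neg_cancel]
  · rintro j ⟨hj1, hj2⟩
    rw [h0, smul_zero]
    have hj1' : (j : ℕ) ≠ i := fun h => hj1 (Fin.ext h)
    have hj2' : (j : ℕ) ≠ i + 1 := fun h => hj2 (Fin.ext h)
    rcases lt_or_gt_of_ne hj1' with h | h
    · refine ⟨⟨(i : ℕ) - 1, by omega⟩, ?_⟩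
      rw [Fin.contractNth_apply_of_gt _ _ _ _ (by simp only [Fin.val_succ]; omega), ← hyi]
      congr 1
      ext
      simp only [Fin.val_succ]
      omega
    · refine ⟨⟨(i : ℕ), by omega⟩, ?_⟩
      rw [Fin.contractNth_apply_of_lt _ _ _ _ (by simp only [Fin.val_succ]; omega), ← hyi]
      rfl

lemma barD_mem_cochains (n : ℕ) {f : (Fin n → T.El G) → A.carrier} (hf : f ∈ cochains A n) :
    barD n f ∈ cochains A (n + 1) := by
  let P : C := ∏ᶜ fun _ : Fin (n + 1) => G
  let S : AddSubgroup (T.El P → A.carrier) :=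
    { carrier := A.rig.maps P, zero_mem' := A.zero_mem P, add_mem' := A.add_mem,
      neg_mem' := A.neg_mem }
  let q : Fin (n + 1) → (P ⟶ G) := Pi.π (fun _ : Fin (n + 1) => G)
  have key : ∀ t : Fin n → (P ⟶ G), (fun p => f (fun k => T.map (t k) p)) ∈ S := by
    intro t
    have h := A.rig.comp_mem (Pi.lift t) hf
    have e : (f ∘ coords T G n) ∘ T.map (Pi.lift t) = fun p => f (fun k => T.map (t k) p) := by
      ext p
      simp only [Function.comp_apply, coords_lift]
    rwa [e] at h
  have h₁ : (fun p => T.map (q 0) p • f (fun k => T.map (q k.succ) p)) ∈ S := by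
    have h := A.rig.comp_mem (lift (q 0) (𝟙 P)) (A.smul_mem (key fun k => q k.succ))
    simp only [Function.comp_def, ← map_comp, lift_fst, lift_snd_assoc, Category.id_comp] at h
    exact h
  have h₂ : ∀ j : Fin (n + 1),
      (fun p => f (Fin.contractNth j (· * ·) (fun k => T.map (q k) p))) ∈ S := by
    intro j
    convert key (fun k => if (k : ℕ) < j then q k.castSucc else
      if (k : ℕ) = j then CartesianMonoidalCategory.lift (q k.castSucc) (q k.succ) ≫ μ
        else q k.succ) using 3 with p
    ext k
    simp only [Fin.contractNth]
    split_ifs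
    · rfl
    · rw [map_lift_mul]
    · rfl
  have h₃ := S.add_mem h₁ (S.sum_mem (t := Finset.univ) fun j _ =>
    S.zsmul_mem (h₂ j) ((-1 : ℤ) ^ ((j : ℕ) + 1)))
  change barD n f ∘ coords T G (n + 1) ∈ S
  convert h₃ using 1
  ext p
  simp only [Function.comp_apply, barD, Pi.add_apply, Finset.sum_apply, Pi.smul_apply]
  rfl

lemma barD_mem_normCochains (n : ℕ) {f : (Fin n → T.El G) → A.carrier}
    (hf : f ∈ normCochains A n) : barD n f ∈ normCochains A (n + 1) :=
  ⟨barD_mem_cochains A n hf.1, barD_eq_zero f hf.2⟩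

/-- The differential on normalised cochains. -/
def normD (n : ℕ) : normCochains A n →+ normCochains A (n + 1) where
  toFun f := ⟨barD n f.1, barD_mem_normCochains A n f.2⟩
  map_zero' := by
    ext x
    simp [barD]
  map_add' f g := by
    ext x
    simp only [barD, AddSubgroup.coe_add, Pi.add_apply, smul_add, Finset.sum_add_distrib]
    abel

/-- The complex `C^•(G, A)` of normalised cochains, in degrees `n ≥ 0`. -/
def cochainComplexNat : CochainComplex AddCommGrpCat.{w} ℕ :=
  CochainComplex.of (fun n => AddCommGrpCat.of (normCochains A n))
    (fun n => AddCommGrpCat.ofHom (normD A n)) (fun n => by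
      ext f
      exact congrFun (barD_barD n f.1) _)

/-- The complex `C^•(G, A)` of normalised cochains, extended by zero to negative degrees. -/
def cochainComplex : CochainComplex AddCommGrpCat.{w} ℤ :=
  (cochainComplexNat A).extend ComplexShape.embeddingUpNat

end Cochains

/-! ### Induction -/

section Induction

variable {T} {D G H : C} [BraidedCategory C] [MonObj D] [MonObj G] [MonObj H]
  (i : H ⟶ G) (A : T.RigidModule (D ⊗ H))

/-- The underlying group of `Ind_G^H(A)`: maps `φ : G → A` in the rigidification of `A` such that
`φ (h g) = h • φ g`. -/
def indCarrier : AddSubgroup (T.El G → A.carrier) where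
  carrier := {φ | φ ∈ A.rig.maps G ∧ ∀ (h : T.El H) (g : T.El G),
    φ (T.map i h * g) = T.pair (1 : T.El D) h • φ g}
  zero_mem' := ⟨A.zero_mem _, fun _ _ => by simp⟩
  add_mem' := fun hφ hψ => ⟨A.add_mem hφ.1 hψ.1, fun h g => by
    simp only [Pi.add_apply, hφ.2, hψ.2, smul_add]⟩
  neg_mem' := fun hφ => ⟨A.neg_mem hφ.1, fun h g => by
    simp only [Pi.neg_apply, hφ.2, smul_neg]⟩

lemma mem_indCarrier {φ : T.El G → A.carrier} : φ ∈ indCarrier i A ↔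
    φ ∈ A.rig.maps G ∧ ∀ (h : T.El H) (g : T.El G),
      φ (T.map i h * g) = T.pair (1 : T.El D) h • φ g := Iff.rfl

lemma smul_fst_mem {Z : C} (d : Z ⟶ D) {f : T.El Z → A.carrier} (hf : f ∈ A.rig.maps Z) :
    (fun z => T.pair (T.map d z) (1 : T.El H) • f z) ∈ A.rig.maps Z := by
  have h := A.rig.comp_mem (lift (lift d (toUnit Z ≫ η[H])) (𝟙 Z)) (A.smul_mem hf)
  convert h using 1
  ext z
  simp only [Function.comp_apply, ← map_comp, lift_fst, lift_snd, map_id]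
  congr 1
  apply T.ext_prod
  · rw [fst_pair, ← map_comp, lift_fst]
  · rw [snd_pair, ← map_comp, lift_snd, map_toUnit_one]

/-- The action of `D × G` on `Ind_G^H(A)`: the factor `D` acts on values, and the factor `G` by
right translation, `((d, g) φ) σ = d • φ (σ g)`. -/
instance indAction : DistribMulAction (T.El (D ⊗ G)) (indCarrier i A) where
  smul p φ := ⟨fun σ => T.pair (T.map (fst D G) p) (1 : T.El H) • φ.1 (σ * T.map (snd D G) p), by
    have := T.disc_preservesFiniteLimits
    refine ⟨?_, fun h g => ?_⟩
    · have h₁ := A.rig.comp_mem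
        (lift (𝟙 G) (T.const G (T.map (snd D G) p)) ≫ μ) φ.2.1
      have h₂ := smul_fst_mem A (T.const G (T.map (fst D G) p)) h₁
      simpa only [Function.comp_apply, map_lift_mul, map_const, map_id] using h₂
    · change T.pair (T.map (fst D G) p) (1 : T.El H) • φ.1 (T.map i h * g * T.map (snd D G) p) =
        T.pair (1 : T.El D) h • T.pair (T.map (fst D G) p) (1 : T.El H) •
          φ.1 (g * T.map (snd D G) p)
      rw [mul_assoc, φ.2.2, smul_smul, smul_smul, pair_mul_pair, pair_mul_pair]
      simp only [mul_one, one_mul]⟩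
  one_smul φ := by
    ext σ
    change T.pair (T.map (fst D G) 1) (1 : T.El H) • φ.1 (σ * T.map (snd D G) 1) = φ.1 σ
    rw [map_hom_one, map_hom_one, pair_one_one, one_smul, mul_one]
  mul_smul p q φ := by
    ext σ
    change T.pair (T.map (fst D G) (p * q)) (1 : T.El H) • φ.1 (σ * T.map (snd D G) (p * q)) =
      T.pair (T.map (fst D G) p) (1 : T.El H) • T.pair (T.map (fst D G) q) (1 : T.El H) •
        φ.1 (σ * T.map (snd D G) p * T.map (snd D G) q)
    rw [map_hom_mul, map_hom_mul, smul_smul, pair_mul_pair, mul_one, mul_assoc]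
  smul_zero p := by
    ext σ
    exact smul_zero _
  smul_add p φ ψ := by
    ext σ
    exact smul_add _ _ _

/-- The induced module `Ind_G^H(A)`, for a module `A` over `D × H` and a morphism `i : H ⟶ G`. It
is a module over `D × G`. Its rigidification consists of the maps `f` from `X` to the maps `G → A`
for which `(x, g) ↦ f x g` belongs to the rigidification of `A` on `X × G` and
`f x (h g) = h • f x g`. -/
def ind : T.RigidModule (D ⊗ G) where
  carrier := indCarrier i A
  rig :=
    { maps := fun X => {f | (fun p : T.El (X ⊗ G) =>
        (f (T.map (fst X G) p)).1 (T.map (snd X G) p)) ∈ A.rig.maps (X ⊗ G)}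
      comp_mem := fun {X X'} φ {f} hf => by
        have h := A.rig.comp_mem (φ ▷ G) hf
        simpa only [Function.comp_def, ← map_comp, whiskerRight_fst, whiskerRight_snd,
          Set.mem_ofPred_eq] using h
      pt_mem := fun f => by
        have h := A.rig.comp_mem (snd T.pt G) (f (T.ptElt)).2.1
        have e : f = fun _ => f T.ptElt := funext fun _ => congrArg f (T.pt_subsingleton _ _)
        rw [e]
        exact h }
  zero_mem X := A.zero_mem _
  add_mem hf hg := A.add_mem hf hg
  neg_mem hf := A.neg_mem hf
  smul_mem {X f} hf := by
    let Z : C := ((D ⊗ G) ⊗ X) ⊗ G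
    let pd : Z ⟶ D := fst _ _ ≫ fst _ _ ≫ fst _ _
    let pg : Z ⟶ G := fst _ _ ≫ fst _ _ ≫ snd _ _
    let px : Z ⟶ X := fst _ _ ≫ snd _ _
    let ps : Z ⟶ G := snd _ _
    have h := smul_fst_mem A pd (A.rig.comp_mem (lift px (lift ps pg ≫ μ)) hf)
    simp only [Function.comp_def, ← map_comp, lift_fst, lift_snd] at h
    simp only [map_lift_mul] at h
    simp only [pd, pg, px, ps, map_comp] at h
    exact h

end Induction

end TopologicalCategory

end

noncomputable section

/-! ### Simplicial operators on sequences -/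

namespace HomogeneousBar

/-! Shapiro's lemma is proved by an explicit homotopy equivalence, in coordinates that are bar-like
in `D` and homogeneous in `G`. An `n`-simplex consists of letters `d 0, …, d n` in `D` and vertices
`s 0, …, s n` in `G`; its inhomogeneous coordinates are `(d (k + 1), (s k)⁻¹ * s (k + 1))`. Since
`D` is only a monoid, its letters cannot be traded for vertices. Face `a` multiplies two adjacent
letters and omits vertex `a`.

Cochains with values in the induced module correspond to functions `K` of such simplices with values
in `A` that are `D`-equivariant in `d 0` and `H`-equivariant under simultaneous left translation of
the vertices (`indEquiv`). Cochains of `D × H` with values in `A` are the same thing with vertices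
in `H` (`selfEquiv`). Both identifications respect the differentials because of
`contractNth_allEntries`.

The group now enters the complex only as a space of vertices with a left `H`-action, so every
`H`-equivariant morphism induces a map of complexes, homomorphism or not. The inclusion `i` and the
retraction `r` give maps in both directions. Both composites come from `H`-equivariant endomorphisms
`ρ`, and the prism operator makes any such map homotopic to the identity (`homPullback_sub_id`,
resting on `sum_simplicial_homotopy`). -/

/-- Multiply the entries in positions `a` and `a + 1`. -/
def contract {M : Type*} [Mul M] (a : ℕ) (d : ℕ → M) (k : ℕ) : M :=
  if k < a then d k else if k = a then d k * d (k + 1) else d (k + 1)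

/-- Omit the entry in position `a`. -/
def skip {S : Type*} (a : ℕ) (s : ℕ → S) (k : ℕ) : S :=
  if k < a then s k else s (k + 1)

/-- Insert the entry `1` in position `j + 1`. -/
def insertOne {M : Type*} [One M] (j : ℕ) (d : ℕ → M) (k : ℕ) : M :=
  if k ≤ j then d k else if k = j + 1 then 1 else d (k - 1)

/-- The sequence `s 0, …, s j, ρ (s j), ρ (s (j + 1)), …`. -/
def prism {S : Type*} (ρ : S → S) (j : ℕ) (s : ℕ → S) (k : ℕ) : S :=
  if k ≤ j then s k else ρ (s (k - 1))

/-! ### Face relations of the prisms, for letters and vertices in parallel. -/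

section Identities

variable {M S : Type*} [Monoid M] (ρ : S → S) (d : ℕ → M) (s : ℕ → S)

lemma contract_insertOne_of_lt {a j : ℕ} (h : a ≤ j) :
    contract a (insertOne (j + 1) d) = insertOne j (contract a d) := by
  funext k
  rcases k with _ | k <;> simp only [contract, insertOne] <;>
    split_ifs <;> first | omega | rfl

lemma skip_prism_of_lt {a j : ℕ} (h : a ≤ j) :
    skip a (prism ρ (j + 1) s) = prism ρ j (skip a s) := by
  funext k
  rcases k with _ | k <;> simp only [skip, prism] <;>
    split_ifs <;> first | omega | rfl

lemma contract_insertOne_of_gt {a j : ℕ} (h : j < a) :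
    contract (a + 1) (insertOne j d) = insertOne j (contract a d) := by
  funext k
  rcases k with _ | k <;> simp only [contract, insertOne] <;>
    split_ifs <;> first | omega | rfl

lemma skip_prism_of_gt {a j : ℕ} (h : j < a) :
    skip (a + 1) (prism ρ j s) = prism ρ j (skip a s) := by
  funext k
  rcases k with _ | k <;> simp only [skip, prism] <;>
    split_ifs <;> first | omega | rfl

/-- The inserted `1` is absorbed from the left or from the right. Together with `skip_prism_succ`
this says that consecutive prisms share a face, which makes the homotopy sum telescope. -/
lemma contract_insertOne_succ (j : ℕ) :
    contract (j + 1) (insertOne j d) = contract (j + 1) (insertOne (j + 1) d) := by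
  funext k
  simp only [contract, insertOne]
  split_ifs <;> first | omega | rfl | simp_all

lemma skip_prism_succ (j : ℕ) :
    skip (j + 1) (prism ρ j s) = skip (j + 1) (prism ρ (j + 1) s) := by
  funext k
  simp only [skip, prism]
  split_ifs <;> first | omega | rfl

lemma contract_insertOne_zero : contract 0 (insertOne 0 d) = d := by
  funext k
  rcases k with _ | k <;> simp [contract, insertOne]

lemma skip_prism_zero : skip 0 (prism ρ 0 s) = ρ ∘ s := by
  funext k
  simp [skip, prism]

end Identities

/-- Here `u a j` stands for face `a` of prism `j`, and `w a j` for prism `j` over face `a`.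
Off-diagonal faces cancel against the `w` terms; the diagonal ones `u j j - u (j + 1) j` telescope
to the two ends. -/
lemma sum_simplicial_homotopy {A : Type*} [AddCommGroup A] (n : ℕ) (u w : ℕ → ℕ → A)
    (hlt : ∀ a j, a ≤ j → u a (j + 1) = w a j)
    (hgt : ∀ a j, j < a → u (a + 1) j = w a j)
    (hmid : ∀ j, u (j + 1) j = u (j + 1) (j + 1)) :
    ∑ j ∈ Finset.range (n + 1), (-1 : ℤ) ^ j • ∑ a ∈ Finset.range (n + 2), (-1 : ℤ) ^ a • u a j +
      ∑ a ∈ Finset.range (n + 1), (-1 : ℤ) ^ a • ∑ j ∈ Finset.range n, (-1 : ℤ) ^ j • w a j =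
    u 0 0 - u (n + 1) n := by
  let V (j : ℕ) : A := ∑ a ∈ Finset.range (j + 1), (-1 : ℤ) ^ a • w a j
  let W (j : ℕ) : A := ∑ a ∈ Finset.Ico (j + 1) (n + 1), (-1 : ℤ) ^ a • w a j
  -- Split at the diagonal faces `a = j` and `a = j + 1`; the index shift above them produces the
  -- sign in front of `W j`.
  have row (j : ℕ) (hj : j ∈ Finset.range (n + 1)) :
      ∑ a ∈ Finset.range (n + 2), (-1 : ℤ) ^ a • u a j =
        (∑ a ∈ Finset.range j, (-1 : ℤ) ^ a • u a j) + (-1 : ℤ) ^ j • (u j j - u (j + 1) j) -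
          W j := by
    rw [Finset.mem_range] at hj
    rw [← Finset.sum_range_add_sum_Ico _ (show j ≤ n + 2 by omega),
      Finset.sum_eq_sum_Ico_succ_bot (by omega), Finset.sum_eq_sum_Ico_succ_bot (by omega),
      ← Finset.sum_Ico_add' _ (j + 1) (n + 1) 1, sub_eq_add_neg _ (W j), ← Finset.sum_neg_distrib]
    have : ∑ a ∈ Finset.Ico (j + 1) (n + 1), (-1 : ℤ) ^ (a + 1) • u (a + 1) j =
        ∑ a ∈ Finset.Ico (j + 1) (n + 1), -((-1 : ℤ) ^ a • w a j) := by
      refine Finset.sum_congr rfl fun a ha => ?_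
      rw [hgt a j (by have := (Finset.mem_Ico.mp ha).1; omega), pow_succ, mul_neg_one, neg_smul]
    rw [this, pow_succ, mul_neg_one, neg_smul, smul_sub]
    abel
  have col (j : ℕ) (hj : j ∈ Finset.range n) :
      ∑ a ∈ Finset.range (n + 1), (-1 : ℤ) ^ a • w a j = V j + W j := by
    rw [Finset.mem_range] at hj
    exact (Finset.sum_range_add_sum_Ico _ (by omega)).symm
  have swap : ∑ a ∈ Finset.range (n + 1), (-1 : ℤ) ^ a •
        ∑ j ∈ Finset.range n, (-1 : ℤ) ^ j • w a j =
      ∑ j ∈ Finset.range n, (-1 : ℤ) ^ j • (V j + W j) := by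
    rw [← Finset.sum_congr rfl fun j hj => congrArg _ (col j hj)]
    simp only [Finset.smul_sum]
    rw [Finset.sum_comm]
    exact Finset.sum_congr rfl fun j _ => Finset.sum_congr rfl fun a _ => smul_comm _ _ _
  have sq (j : ℕ) (x : A) : (-1 : ℤ) ^ j • (-1 : ℤ) ^ j • x = x := by
    rw [smul_smul, ← pow_add, Even.neg_one_pow ⟨j, rfl⟩, one_smul]
  have hV : ∑ j ∈ Finset.range (n + 1), (-1 : ℤ) ^ j •
        ∑ a ∈ Finset.range j, (-1 : ℤ) ^ a • u a j =
      -∑ j ∈ Finset.range n, (-1 : ℤ) ^ j • V j := by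
    rw [Finset.sum_range_succ', Finset.sum_range_zero, smul_zero, add_zero,
      ← Finset.sum_neg_distrib]
    refine Finset.sum_congr rfl fun j _ => ?_
    rw [pow_succ, mul_neg_one, neg_smul]
    congr 2
    refine Finset.sum_congr rfl fun a ha => ?_
    rw [hlt a j (by have := Finset.mem_range.mp ha; omega)]
  have hW : ∑ j ∈ Finset.range (n + 1), (-1 : ℤ) ^ j • W j =
      ∑ j ∈ Finset.range n, (-1 : ℤ) ^ j • W j := by
    rw [Finset.sum_range_succ]
    simp [W]
  have htel : ∑ j ∈ Finset.range (n + 1), (u j j - u (j + 1) j) = u 0 0 - u (n + 1) n := by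
    simp only [hmid]
    rw [Finset.sum_range_sub' (fun j => u j j)]
  rw [swap, Finset.sum_congr rfl fun j hj => congrArg _ (row j hj)]
  simp only [smul_sub, smul_add, Finset.sum_add_distrib, Finset.sum_sub_distrib]
  simp only [Finset.sum_sub_distrib] at htel
  rw [hV, hW]
  simp only [sq]
  rw [htel]
  abel

end HomogeneousBar

namespace TopologicalCategory

open HomogeneousBar

variable {C : Type u} [Category.{v} C] [HasFiniteLimits C] [CartesianMonoidalCategory C]

/-! ### Computing with maps of underlying sets that come from morphisms. -/

section Underlying

variable (T : TopologicalCategory.{u, v, w} C)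

/-- The group structure on the underlying set of a group object. -/
scoped instance elGroup (G : C) [GrpObj G] : Group (T.El G) :=
  { T.elMonoid G with
    inv := T.map ι[G]
    inv_mul_cancel := fun a => by
      have h := T.map_lift_mul ι[G] (𝟙 G) a
      rw [GrpObj.left_inv, map_toUnit_one, map_id] at h
      exact h.symm }

/-- A map of underlying sets which is induced by a morphism. -/
def IsMor {Z X : C} (a : T.El Z → T.El X) : Prop := ∃ m : Z ⟶ X, T.map m = a

variable {T}

lemma isMor_map {Z X : C} (m : Z ⟶ X) : T.IsMor (T.map m) := ⟨m, rfl⟩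

lemma isMor_id {Z : C} : T.IsMor (fun z : T.El Z => z) := ⟨𝟙 Z, funext fun z => T.map_id z⟩

lemma isMor_const {Z X : C} (x : T.El X) : T.IsMor (fun _ : T.El Z => x) :=
  have := T.disc_preservesFiniteLimits
  ⟨T.const Z x, funext fun z => T.map_const x z⟩

lemma IsMor.map {Z X Y : C} {a : T.El Z → T.El X} (ha : T.IsMor a) (m : X ⟶ Y) :
    T.IsMor (fun z => T.map m (a z)) := by
  obtain ⟨a, rfl⟩ := ha
  exact ⟨a ≫ m, funext fun z => T.map_comp a m z⟩

lemma IsMor.comp_map {Z X Y : C} {a : T.El X → T.El Y} (ha : T.IsMor a) (m : Z ⟶ X) :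
    T.IsMor (fun z => a (T.map m z)) := by
  obtain ⟨a, rfl⟩ := ha
  exact ⟨m ≫ a, funext fun z => T.map_comp m a z⟩

lemma IsMor.mul {Z G : C} [MonObj G] {a b : T.El Z → T.El G} (ha : T.IsMor a)
    (hb : T.IsMor b) : T.IsMor (fun z => a z * b z) := by
  obtain ⟨a, rfl⟩ := ha
  obtain ⟨b, rfl⟩ := hb
  exact ⟨lift a b ≫ μ, funext fun z => T.map_lift_mul a b z⟩

lemma IsMor.inv {Z G : C} [GrpObj G] {a : T.El Z → T.El G} (ha : T.IsMor a) :
    T.IsMor (fun z => (a z)⁻¹) := ha.map ι[G]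

lemma IsMor.pair {Z X Y : C} {a : T.El Z → T.El X} {b : T.El Z → T.El Y} (ha : T.IsMor a)
    (hb : T.IsMor b) : T.IsMor (fun z => T.pair (a z) (b z)) := by
  obtain ⟨a, rfl⟩ := ha
  obtain ⟨b, rfl⟩ := hb
  refine ⟨lift a b, funext fun z => T.ext_prod ?_ ?_⟩
  · rw [fst_pair, ← map_comp, lift_fst]
  · rw [snd_pair, ← map_comp, lift_snd]

lemma pair_fst_snd {X Y : C} (p : T.El (X ⊗ Y)) :
    T.pair (T.map (fst X Y) p) (T.map (snd X Y) p) = p :=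
  T.ext_prod (fst_pair ..) (snd_pair ..)

lemma RigidSet.comp_isMor_mem {Y : Type w} (h : T.RigidSet Y) {Z X : C} {f : T.El X → Y}
    (hf : f ∈ h.maps X) {a : T.El Z → T.El X} (ha : T.IsMor a) :
    (fun z => f (a z)) ∈ h.maps Z := by
  obtain ⟨a, rfl⟩ := ha
  exact h.comp_mem a hf

lemma isMor_coords {M : C} (n : ℕ) (k : Fin n) :
    T.IsMor (fun p : T.El (∏ᶜ fun _ : Fin n => M) => coords T M n p k) :=
  isMor_map (Pi.π (fun _ : Fin n => M) k)

/-- A tuple of morphisms is a morphism to the power, so membership of cochains can be tested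
coordinate by coordinate. -/
lemma exists_coords_eq {Z M : C} {n : ℕ} {x : T.El Z → Fin n → T.El M}
    (hx : ∀ k, T.IsMor (fun z => x z k)) :
    ∃ a : T.El Z → T.El (∏ᶜ fun _ : Fin n => M), T.IsMor a ∧ ∀ z, coords T M n (a z) = x z := by
  choose t ht using hx
  refine ⟨T.map (Pi.lift t), isMor_map _, fun z => ?_⟩
  rw [coords_lift]
  exact funext fun k => congrFun (ht k) z

variable {M : C} [MonObj M] {A : T.RigidModule M}

lemma smul_isMor_mem {Z : C} {m : T.El Z → T.El M} (hm : T.IsMor m) {f : T.El Z → A.carrier}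
    (hf : f ∈ A.rig.maps Z) : (fun z => m z • f z) ∈ A.rig.maps Z := by
  have h := A.rig.comp_isMor_mem (A.smul_mem hf) (hm.pair isMor_id)
  simpa only [fst_pair, snd_pair] using h

lemma cochains_comp_isMor_mem {n : ℕ} {f : (Fin n → T.El M) → A.carrier} (hf : f ∈ cochains A n)
    {Z : C} {x : T.El Z → Fin n → T.El M} (hx : ∀ k, T.IsMor (fun z => x z k)) :
    (fun z => f (x z)) ∈ A.rig.maps Z := by
  obtain ⟨a, ha, e⟩ := exists_coords_eq hx
  simpa only [Function.comp_apply, e] using A.rig.comp_isMor_mem hf ha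

variable (A) in
lemma cochainComplexNat_d (n : ℕ) :
    (cochainComplexNat A).d n (n + 1) = AddCommGrpCat.ofHom (normD A n) :=
  CochainComplex.of_d (fun n => AddCommGrpCat.of (normCochains A n))
    (fun n => AddCommGrpCat.ofHom (normD A n)) n

end Underlying

/-! ### Inhomogeneous and homogeneous coordinates -/

section Coordinates

variable {T : TopologicalCategory.{u, v, w} C} {D G : C}

lemma map_comp_skip {G' : C} (φ : G ⟶ G') (a : ℕ) (s : ℕ → T.El G) :
    T.map φ ∘ skip a s = skip a (T.map φ ∘ s) :=
  funext fun _ => apply_ite ..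

lemma isMor_prism {Z : C} {s : T.El Z → ℕ → T.El G} (hs : ∀ k, T.IsMor (fun z => s z k))
    (ρ : G ⟶ G) (j k : ℕ) : T.IsMor (fun z => prism (T.map ρ) j (s z) k) := by
  unfold prism
  split_ifs
  exacts [hs _, (hs _).map ρ]

section

variable [MonObj D]

/-- The sequence in `D` with initial term `1` and subsequent terms the first components of `x`. -/
def discSeq {n : ℕ} (x : Fin n → T.El (D ⊗ G)) : ℕ → T.El D
  | 0 => 1
  -- The value beyond `n` is immaterial: homogeneous `n`-cochains see only the indices `0, …, n`.
  | k + 1 => if h : k < n then T.map (fst D G) (x ⟨k, h⟩) else 1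

lemma isMor_discSeq {Z : C} {n : ℕ} {x : T.El Z → Fin n → T.El (D ⊗ G)}
    (hx : ∀ k, T.IsMor (fun z => x z k)) (k : ℕ) : T.IsMor (fun z => discSeq (x z) k) := by
  cases k with
  | zero => exact isMor_const 1
  | succ k =>
    by_cases h : k < n
    · simpa only [discSeq, h, dite_true] using (hx ⟨k, h⟩).map (fst D G)
    · simpa only [discSeq, h, dite_false] using isMor_const 1

lemma isMor_insertOne {Z : C} {d : T.El Z → ℕ → T.El D} (hd : ∀ k, T.IsMor (fun z => d z k))
    (j k : ℕ) : T.IsMor (fun z => insertOne j (d z) k) := by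
  unfold insertOne
  split_ifs
  exacts [hd _, isMor_const 1, hd _]

end

section

variable [MonObj G]

/-- The partial products `σ * g 0 * ⋯ * g (k - 1)` of the second components of `x`. -/
def vertexSeq {n : ℕ} (x : Fin n → T.El (D ⊗ G)) (σ : T.El G) : ℕ → T.El G
  | 0 => σ
  | k + 1 => vertexSeq x σ k * if h : k < n then T.map (snd D G) (x ⟨k, h⟩) else 1

lemma isMor_vertexSeq {Z : C} {n : ℕ} {x : T.El Z → Fin n → T.El (D ⊗ G)}
    (hx : ∀ k, T.IsMor (fun z => x z k)) {s : T.El Z → T.El G} (hs : T.IsMor s) (k : ℕ) :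
    T.IsMor (fun z => vertexSeq (x z) (s z) k) := by
  induction k with
  | zero => exact hs
  | succ k ih =>
    by_cases h : k < n
    · simpa only [vertexSeq, h, dite_true] using ih.mul ((hx ⟨k, h⟩).map (snd D G))
    · simpa only [vertexSeq, h, dite_false, mul_one] using ih

end

variable [GrpObj G]

lemma vertexSeq_mul_left {n : ℕ} (x : Fin n → T.El (D ⊗ G)) (g σ : T.El G) (k : ℕ) :
    vertexSeq x (g * σ) k = g * vertexSeq x σ k := by
  induction k with
  | zero => rfl
  | succ k ih => rw [vertexSeq, ih, mul_assoc, vertexSeq]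

/-- The inhomogeneous coordinates of a simplex. -/
def entries (n : ℕ) (d : ℕ → T.El D) (s : ℕ → T.El G) (k : Fin n) : T.El (D ⊗ G) :=
  T.pair (d (k + 1)) ((s k)⁻¹ * s (k + 1))

/-- The inhomogeneous coordinates of a simplex, preceded by its initial vertex. -/
def allEntries (n : ℕ) (d : ℕ → T.El D) (s : ℕ → T.El G) : Fin (n + 1) → T.El (D ⊗ G) :=
  Fin.cons (T.pair (d 0) (s 0)) (entries n d s)

lemma vertexSeq_entries {n : ℕ} (d : ℕ → T.El D) (s : ℕ → T.El G) {k : ℕ} (hk : k ≤ n) :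
    vertexSeq (entries n d s) (s 0) k = s k := by
  induction k with
  | zero => rfl
  | succ k ih =>
    have hk' : k < n := hk
    simp [vertexSeq, ih hk'.le, hk', entries]

lemma isMor_entries {Z : C} {n : ℕ} {d : T.El Z → ℕ → T.El D} {s : T.El Z → ℕ → T.El G}
    (hd : ∀ k, T.IsMor (fun z => d z k)) (hs : ∀ k, T.IsMor (fun z => s z k)) (k : Fin n) :
    T.IsMor (fun z => entries n (d z) (s z) k) :=
  (hd _).pair ((hs _).inv.mul (hs _))

lemma entries_congr {n : ℕ} {d d' : ℕ → T.El D} {s s' : ℕ → T.El G}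
    (hd : ∀ k < n, d (k + 1) = d' (k + 1)) (hs : ∀ k ≤ n, s k = s' k) :
    entries n d s = entries n d' s' := by
  ext k
  rw [entries, entries, hd k k.2, hs k k.2.le, hs (k + 1) k.2]

lemma entries_update (n : ℕ) (d : ℕ → T.El D) (e : T.El D) (s : ℕ → T.El G) :
    entries n (Function.update d 0 e) s = entries n d s :=
  entries_congr (fun k _ => Function.update_of_ne (by omega) _ _) fun _ _ => rfl

/-- The quotients `(s k)⁻¹ * s (k + 1)` are invariant under left translation, so equivariance of a
homogenised cochain concerns only the initial vertex. -/
lemma entries_mul_left (n : ℕ) (d : ℕ → T.El D) (g : T.El G) (s : ℕ → T.El G) :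
    entries n d (fun k => g * s k) = entries n d s := by
  ext k
  simp only [entries, mul_inv_rev, mul_assoc, inv_mul_cancel_left]

variable [MonObj D]

lemma entries_discSeq_vertexSeq {n : ℕ} (x : Fin n → T.El (D ⊗ G)) (σ : T.El G) :
    entries n (discSeq x) (vertexSeq x σ) = x := by
  ext k
  simp only [entries, discSeq, vertexSeq, k.2, dite_true, inv_mul_cancel_left, pair_fst_snd]

lemma discSeq_entries {n : ℕ} (d : ℕ → T.El D) (s : ℕ → T.El G) {k : ℕ} (hk : k < n) :
    discSeq (entries n d s) (k + 1) = d (k + 1) := by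
  simp [discSeq, hk, entries]

lemma update_discSeq_entries {n : ℕ} (d : ℕ → T.El D) (s : ℕ → T.El G) {k : ℕ} (hk : k ≤ n) :
    Function.update (discSeq (entries n d s)) 0 (d 0 * discSeq (entries n d s) 0) k = d k := by
  cases k with
  | zero => simp [discSeq]
  | succ k => rw [Function.update_of_ne (by omega), discSeq_entries d s hk]

variable [BraidedCategory C]

lemma entries_eq_one {n : ℕ} {d : ℕ → T.El D} {s : ℕ → T.El G} {k : ℕ} (hk : k < n)
    (hd : d (k + 1) = 1) (hs : s k = s (k + 1)) : entries n d s ⟨k, hk⟩ = 1 := by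
  rw [entries, hd, hs, inv_mul_cancel, pair_one_one]

lemma discSeq_eq_one {n : ℕ} {x : Fin n → T.El (D ⊗ G)} {k : Fin n} (h : x k = 1) :
    discSeq x (k + 1) = 1 := by
  simp [discSeq, h, map_hom_one]

lemma vertexSeq_succ_eq {n : ℕ} {x : Fin n → T.El (D ⊗ G)} {k : Fin n} (h : x k = 1)
    (σ : T.El G) : vertexSeq x σ k = vertexSeq x σ (k + 1) := by
  simp [vertexSeq, h, map_hom_one]

/-- Multiplying adjacent quotients cancels the vertex between them, while the letters in `D`
genuinely multiply. For `a = 0` the initial entry absorbs the next one and the initial vertex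
becomes `s 1`; the top face merely drops the last entry. -/
lemma contractNth_allEntries (n : ℕ) (d : ℕ → T.El D) (s : ℕ → T.El G) (a : Fin (n + 2)) :
    Fin.contractNth a (· * ·) (allEntries (n + 1) d s) =
      allEntries n (contract a d) (skip a s) := by
  have h0 : allEntries (n + 1) d s 0 = T.pair (d 0) (s 0) := rfl
  have hs (k : Fin (n + 1)) : allEntries (n + 1) d s k.succ =
    T.pair (d (k + 1)) ((s k)⁻¹ * s (k + 1)) := rfl
  ext k
  cases k using Fin.cases with
  | zero =>
    simp only [Fin.contractNth, Fin.castSucc_zero, h0, hs]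
    change _ = T.pair (contract a d 0) (skip a s 0)
    obtain rfl | ha := eq_or_ne a 0
    · simp [contract, skip, pair_mul_pair]
    · simp [contract, skip, Nat.pos_of_ne_zero (Fin.val_ne_zero_iff.mpr ha)]
  | succ k =>
    simp only [Fin.contractNth, ← Fin.succ_castSucc, hs, Fin.val_succ, Fin.val_castSucc]
    change _ = T.pair (contract a d (k + 1)) ((skip a s k)⁻¹ * skip a s (k + 1))
    simp only [contract, skip]
    split_ifs <;> first | omega | simp [pair_mul_pair, mul_assoc]

variable {B : Type w} [AddCommGroup B] [DistribMulAction (T.El (D ⊗ G)) B]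

lemma extendLeft_barD_allEntries {n : ℕ} (f : (Fin n → T.El (D ⊗ G)) → B) (d : ℕ → T.El D)
    (s : ℕ → T.El G) : extendLeft (barD n f) (allEntries (n + 1) d s) =
      ∑ a ∈ Finset.range (n + 2), (-1 : ℤ) ^ a •
        extendLeft f (allEntries n (contract a d) (skip a s)) := by
  rw [extendLeft_barD, Finset.sum_range]
  simp only [contractNth_allEntries]

lemma extendLeft_allEntries {n : ℕ} (f : (Fin n → T.El (D ⊗ G)) → B) (d : ℕ → T.El D)
    (s : ℕ → T.El G) :
    extendLeft f (allEntries n d s) = T.pair (d 0) (s 0) • f (entries n d s) := rfl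

end Coordinates

/-! ### Homogeneous cochains -/

section Homogeneous

variable [BraidedCategory C] {T : TopologicalCategory.{u, v, w} C} {D G H : C} [MonObj D]
  [GrpObj G] [GrpObj H] (i : H ⟶ G) (A : T.RigidModule (D ⊗ H))

/-- The conditions on a function of two sequences to be a homogeneous normalised `n`-cochain. -/
structure IsHomogeneous (n : ℕ) (K : (ℕ → T.El D) → (ℕ → T.El G) → A.carrier) : Prop where
  congr : ∀ {d d' : ℕ → T.El D} {s s' : ℕ → T.El G}, (∀ k ≤ n, d k = d' k) →
    (∀ k ≤ n, s k = s' k) → K d s = K d' s'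
  smul_left : ∀ (e : T.El D) (d : ℕ → T.El D) (s : ℕ → T.El G),
    K (Function.update d 0 (e * d 0)) s = T.pair e (1 : T.El H) • K d s
  equivariant : ∀ (h : T.El H) (d : ℕ → T.El D) (s : ℕ → T.El G),
    K d (fun k => T.map i h * s k) = T.pair (1 : T.El D) h • K d s
  -- The sequences are infinite, so instead of fixing a product object membership is required for
  -- every family parametrised by an object `Z`.
  mem : ∀ {Z : C} {d : T.El Z → ℕ → T.El D} {s : T.El Z → ℕ → T.El G},
    (∀ k, T.IsMor (fun z => d z k)) → (∀ k, T.IsMor (fun z => s z k)) →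
      (fun z => K (d z) (s z)) ∈ A.rig.maps Z
  -- Letter and edge must both be trivial: together they say that the inhomogeneous coordinate with
  -- index `k` is `1`.
  normalised : ∀ {d : ℕ → T.El D} {s : ℕ → T.El G} {k : ℕ}, k < n → d (k + 1) = 1 →
    s k = s (k + 1) → K d s = 0

/-- The homogeneous normalised `n`-cochains. -/
def homCochains (n : ℕ) : AddSubgroup ((ℕ → T.El D) → (ℕ → T.El G) → A.carrier) where
  carrier := {K | IsHomogeneous i A n K}
  zero_mem' :=
    { congr := fun _ _ => rfl
      smul_left := fun _ _ _ => (smul_zero _).symm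
      equivariant := fun _ _ _ => (smul_zero _).symm
      mem := fun _ _ => A.zero_mem _
      normalised := fun _ _ _ => rfl }
  add_mem' := fun hK hL =>
    { congr := fun h h' => congrArg₂ (· + ·) (hK.congr h h') (hL.congr h h')
      smul_left := fun e d s => by
        simp only [Pi.add_apply, hK.smul_left, hL.smul_left, smul_add]
      equivariant := fun h d s => by
        simp only [Pi.add_apply, hK.equivariant, hL.equivariant, smul_add]
      mem := fun hd hs => A.add_mem (hK.mem hd hs) (hL.mem hd hs)
      normalised := fun hk hd hs => by
        simp only [Pi.add_apply, hK.normalised hk hd hs, hL.normalised hk hd hs, add_zero] }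
  neg_mem' := fun hK =>
    { congr := fun h h' => congrArg (- ·) (hK.congr h h')
      smul_left := fun e d s => by simp only [Pi.neg_apply, hK.smul_left, smul_neg]
      equivariant := fun h d s => by simp only [Pi.neg_apply, hK.equivariant, smul_neg]
      mem := fun hd hs => A.neg_mem (hK.mem hd hs)
      normalised := fun hk hd hs => by
        simp only [Pi.neg_apply, hK.normalised hk hd hs, neg_zero] }

variable {i A}

lemma pair_smul_pair_smul (a c : T.El D) (b d : T.El H) (x : A.carrier) :
    T.pair a b • T.pair c d • x = T.pair (a * c) (b * d) • x := by
  rw [smul_smul, pair_mul_pair]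

/-- The differential on homogeneous cochains. -/
def coboundary (n : ℕ) (K : (ℕ → T.El D) → (ℕ → T.El G) → A.carrier) (d : ℕ → T.El D)
    (s : ℕ → T.El G) : A.carrier :=
  ∑ a ∈ Finset.range (n + 2), (-1 : ℤ) ^ a • K (contract a d) (skip a s)

/-! ### Homogenising cochains with values in the induced module. -/

section Induced

/-- The homogeneous cochain attached to a cochain with values in the induced module. -/
def indHomogenize (n : ℕ) (f : (Fin n → T.El (D ⊗ G)) → indCarrier i A) (d : ℕ → T.El D)
    (s : ℕ → T.El G) : A.carrier :=
  T.pair (d 0) (1 : T.El H) • (f (entries n d s)).1 (s 0)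

lemma cochains_ind_comp_isMor_mem {n : ℕ} {f : (Fin n → T.El (D ⊗ G)) → indCarrier i A}
    (hf : f ∈ cochains (ind i A) n) {Z : C} {x : T.El Z → Fin n → T.El (D ⊗ G)}
    (hx : ∀ k, T.IsMor (fun z => x z k)) {s : T.El Z → T.El G} (hs : T.IsMor s) :
    (fun z => (f (x z)).1 (s z)) ∈ A.rig.maps Z := by
  obtain ⟨a, ha, e⟩ := exists_coords_eq hx
  have h : (fun z => (f (coords T (D ⊗ G) n (T.map (fst _ G) (T.pair (a z) (s z))))).1
      (T.map (snd _ G) (T.pair (a z) (s z)))) ∈ A.rig.maps Z :=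
    A.rig.comp_isMor_mem hf (ha.pair hs)
  simpa only [fst_pair, snd_pair, e] using h

lemma isHomogeneous_indHomogenize {n : ℕ} {f : (Fin n → T.El (D ⊗ G)) → indCarrier i A}
    (hf : f ∈ normCochains (ind i A) n) : IsHomogeneous i A n (indHomogenize n f) where
  congr hd hs := by
    rw [indHomogenize, indHomogenize, hd 0 (Nat.zero_le n), hs 0 (Nat.zero_le n),
      entries_congr (fun k hk => hd (k + 1) hk) hs]
  smul_left e d s := by
    rw [indHomogenize, indHomogenize, entries_update, Function.update_self, pair_smul_pair_smul,
      one_mul]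
  equivariant h d s := by
    rw [indHomogenize, indHomogenize, entries_mul_left, (f _).2.2, pair_smul_pair_smul,
      pair_smul_pair_smul]
    simp only [one_mul, mul_one]
  mem hd hs :=
    smul_isMor_mem ((hd 0).pair (isMor_const 1))
      (cochains_ind_comp_isMor_mem hf.1 (isMor_entries hd hs) (hs 0))
  normalised {d s k} hk hd hs := by
    have h : f (entries n d s) = 0 := hf.2 _ ⟨_, entries_eq_one hk hd hs⟩
    rw [indHomogenize, h]
    exact smul_zero _

/-- Acting by `(d 0, s 0)` and then evaluating at `1` is evaluation at `s 0` followed by `d 0`. Thus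
the formula for the bar differential on `extendLeft` applies. -/
lemma indHomogenize_eq_extendLeft {n : ℕ} (f : (Fin n → T.El (D ⊗ G)) → indCarrier i A)
    (d : ℕ → T.El D) (s : ℕ → T.El G) :
    indHomogenize n f d s = (extendLeft f (allEntries n d s)).1 1 := by
  rw [extendLeft_allEntries]
  change _ = T.pair (T.map (fst D G) (T.pair (d 0) (s 0))) (1 : T.El H) •
    (f (entries n d s)).1 (1 * T.map (snd D G) (T.pair (d 0) (s 0)))
  rw [fst_pair, snd_pair, one_mul]
  rfl

lemma indHomogenize_barD {n : ℕ} (f : (Fin n → T.El (D ⊗ G)) → indCarrier i A) :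
    indHomogenize (n + 1) (barD n f) = coboundary n (indHomogenize n f) := by
  funext d s
  simp only [coboundary, indHomogenize_eq_extendLeft]
  rw [extendLeft_barD_allEntries, AddSubgroup.val_finsetSum, Finset.sum_apply]
  rfl

/-- The cochain with values in the induced module attached to a homogeneous cochain. -/
def indDehomogenize {n : ℕ} {K : (ℕ → T.El D) → (ℕ → T.El G) → A.carrier}
    (hK : IsHomogeneous i A n K) (x : Fin n → T.El (D ⊗ G)) : indCarrier i A :=
  ⟨fun σ => K (discSeq x) (vertexSeq x σ),
    hK.mem (isMor_discSeq fun _ => isMor_const _)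
      (isMor_vertexSeq (fun k => isMor_const (x k)) isMor_id),
    fun h g => by
      rw [← hK.equivariant]
      exact congrArg _ (funext fun k => vertexSeq_mul_left x _ g k)⟩

lemma indDehomogenize_mem {n : ℕ} {K : (ℕ → T.El D) → (ℕ → T.El G) → A.carrier}
    (hK : IsHomogeneous i A n K) : indDehomogenize hK ∈ normCochains (ind i A) n := by
  refine ⟨?_, fun x ⟨k, hk⟩ => Subtype.ext (funext fun σ => ?_)⟩
  · exact hK.mem (isMor_discSeq fun k => (isMor_coords n k).comp_map (fst _ G))
      (isMor_vertexSeq (fun k => (isMor_coords n k).comp_map (fst _ G))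
        (isMor_map (snd _ G)))
  · exact hK.normalised k.2 (discSeq_eq_one hk) (vertexSeq_succ_eq hk σ)

variable (i A) in
/-- Cochains with values in the induced module are the same as homogeneous cochains. -/
def indEquiv (n : ℕ) : normCochains (ind i A) n ≃+ homCochains i A n where
  toFun f := ⟨indHomogenize n f.1, isHomogeneous_indHomogenize f.2⟩
  invFun K := ⟨indDehomogenize K.2, indDehomogenize_mem K.2⟩
  left_inv f := by
    refine Subtype.ext (funext fun x => Subtype.ext (funext fun σ => ?_))
    change T.pair (1 : T.El D) (1 : T.El H) •
      (f.1 (entries n (discSeq x) (vertexSeq x σ))).1 σ = (f.1 x).1 σ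
    rw [entries_discSeq_vertexSeq, pair_one_one, one_smul]
  right_inv K := by
    refine Subtype.ext (funext fun d => funext fun s => ?_)
    change T.pair (d 0) (1 : T.El H) •
      K.1 (discSeq (entries n d s)) (vertexSeq (entries n d s) (s 0)) = K.1 d s
    rw [← K.2.smul_left]
    exact K.2.congr (fun k hk => update_discSeq_entries d s hk)
      fun k hk => vertexSeq_entries d s hk
  map_add' f g := by
    refine Subtype.ext (funext fun d => funext fun s => ?_)
    exact smul_add _ _ _

end Induced

/-! ### Homogenising cochains with values in `A`. -/

section Self

/-- The homogeneous cochain attached to a cochain with values in `A`. -/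
def homogenize (n : ℕ) (f : (Fin n → T.El (D ⊗ H)) → A.carrier) (d : ℕ → T.El D)
    (s : ℕ → T.El H) : A.carrier :=
  extendLeft f (allEntries n d s)

lemma isHomogeneous_homogenize {n : ℕ} {f : (Fin n → T.El (D ⊗ H)) → A.carrier}
    (hf : f ∈ normCochains A n) : IsHomogeneous (𝟙 H) A n (homogenize n f) where
  congr hd hs := by
    rw [homogenize, homogenize, extendLeft_allEntries, extendLeft_allEntries,
      hd 0 (Nat.zero_le n), hs 0 (Nat.zero_le n), entries_congr (fun k hk => hd (k + 1) hk) hs]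
  smul_left e d s := by
    rw [homogenize, homogenize, extendLeft_allEntries, extendLeft_allEntries, entries_update,
      Function.update_self, pair_smul_pair_smul, one_mul]
  equivariant h d s := by
    rw [homogenize, homogenize, extendLeft_allEntries, extendLeft_allEntries, entries_mul_left,
      pair_smul_pair_smul, one_mul, map_id]
  mem hd hs :=
    smul_isMor_mem ((hd 0).pair (hs 0)) (cochains_comp_isMor_mem hf.1 (isMor_entries hd hs))
  normalised {d s k} hk hd hs := by
    rw [homogenize, extendLeft_allEntries, hf.2 _ ⟨_, entries_eq_one hk hd hs⟩, smul_zero]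

lemma homogenize_barD {n : ℕ} (f : (Fin n → T.El (D ⊗ H)) → A.carrier) :
    homogenize (n + 1) (barD n f) = coboundary n (homogenize n f) := by
  funext d s
  exact extendLeft_barD_allEntries f d s

lemma dehomogenize_mem {n : ℕ} {K : (ℕ → T.El D) → (ℕ → T.El H) → A.carrier}
    (hK : IsHomogeneous (𝟙 H) A n K) :
    (fun x => K (discSeq x) (vertexSeq x 1)) ∈ normCochains A n := by
  refine ⟨?_, fun x ⟨k, hk⟩ => ?_⟩
  · exact hK.mem (isMor_discSeq fun k => isMor_coords n k)
      (isMor_vertexSeq (fun k => isMor_coords n k) (isMor_const 1))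
  · exact hK.normalised k.2 (discSeq_eq_one hk) (vertexSeq_succ_eq hk 1)

variable (A) in
/-- Cochains with values in `A` are the same as homogeneous cochains. -/
def selfEquiv (n : ℕ) : normCochains A n ≃+ homCochains (𝟙 H) A n where
  toFun f := ⟨homogenize n f.1, isHomogeneous_homogenize f.2⟩
  invFun K := ⟨fun x => K.1 (discSeq x) (vertexSeq x 1), dehomogenize_mem K.2⟩
  left_inv f := by
    refine Subtype.ext (funext fun x => ?_)
    change T.pair (1 : T.El D) (1 : T.El H) •
      f.1 (entries n (discSeq x) (vertexSeq x 1)) = f.1 x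
    rw [entries_discSeq_vertexSeq, pair_one_one, one_smul]
  right_inv K := by
    refine Subtype.ext (funext fun d => funext fun s => ?_)
    change T.pair (d 0) (s 0) •
      K.1 (discSeq (entries n d s)) (vertexSeq (entries n d s) 1) = K.1 d s
    -- The factor `(1, s 0)` translates the vertices, which start at `1`, back to start at `s 0`;
    -- the factor `(d 0, 1)` restores the initial letter.
    have h : T.pair (d 0) (s 0) = T.pair (d 0) 1 * T.pair 1 (s 0) := by
      rw [pair_mul_pair, mul_one, one_mul]
    rw [h, mul_smul, ← K.2.equivariant, ← K.2.smul_left]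
    refine K.2.congr (fun k hk => update_discSeq_entries d s hk) fun k hk => ?_
    rw [map_id, ← vertexSeq_mul_left, mul_one, vertexSeq_entries d s hk]
  map_add' f g := by
    refine Subtype.ext (funext fun d => funext fun s => ?_)
    exact smul_add _ _ _

end Self

/-! ### The complex of homogeneous cochains -/

/-- Transported from `barD` through `indEquiv`, which avoids checking the conditions face by face.
-/
lemma isHomogeneous_coboundary {n : ℕ} {K : (ℕ → T.El D) → (ℕ → T.El G) → A.carrier}
    (hK : IsHomogeneous i A n K) : IsHomogeneous i A (n + 1) (coboundary n K) := by
  have e : indHomogenize n (indDehomogenize hK) = K :=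
    congrArg Subtype.val ((indEquiv i A n).right_inv ⟨K, hK⟩)
  have h := isHomogeneous_indHomogenize (barD_mem_normCochains _ n (indDehomogenize_mem hK))
  have h' := indHomogenize_barD (indDehomogenize hK)
  rw [e] at h'
  rw [← h']
  exact h

lemma coboundary_coboundary {n : ℕ} {K : (ℕ → T.El D) → (ℕ → T.El G) → A.carrier}
    (hK : IsHomogeneous i A n K) : coboundary (n + 1) (coboundary n K) = 0 := by
  have e : indHomogenize n (indDehomogenize hK) = K :=
    congrArg Subtype.val ((indEquiv i A n).right_inv ⟨K, hK⟩)
  rw [← e, ← indHomogenize_barD, ← indHomogenize_barD, barD_barD]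
  funext d s
  exact smul_zero _

variable (i A) in
/-- The differential on homogeneous cochains, as a homomorphism. -/
def homD (n : ℕ) : homCochains i A n →+ homCochains i A (n + 1) where
  toFun K := ⟨coboundary n K.1, isHomogeneous_coboundary K.2⟩
  map_zero' := by
    refine Subtype.ext (funext fun d => funext fun s => ?_)
    simp [coboundary]
  map_add' K L := by
    refine Subtype.ext (funext fun d => funext fun s => ?_)
    simp [coboundary, Finset.sum_add_distrib]

variable (i A) in
/-- The complex of homogeneous cochains. -/
def homComplex : CochainComplex AddCommGrpCat.{w} ℕ :=
  CochainComplex.of (fun n => AddCommGrpCat.of (homCochains i A n))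
    (fun n => AddCommGrpCat.ofHom (homD i A n)) (fun n => by
      ext K
      exact congrFun (congrFun (coboundary_coboundary K.2) _) _)

variable (i A) in
lemma homComplex_d (n : ℕ) :
    (homComplex i A).d n (n + 1) = AddCommGrpCat.ofHom (homD i A n) :=
  CochainComplex.of_d (fun n => AddCommGrpCat.of (homCochains i A n))
    (fun n => AddCommGrpCat.ofHom (homD i A n)) n

variable (i A) in
/-- The complex of cochains with values in the induced module, in homogeneous form. -/
def indComplexIso : cochainComplexNat (ind i A) ≅ homComplex i A :=
  HomologicalComplex.Hom.isoOfComponents (fun n => (indEquiv i A n).toAddCommGrpIso) (by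
    rintro n _ rfl
    rw [homComplex_d, cochainComplexNat_d]
    ext f
    exact Subtype.ext (indHomogenize_barD f.1).symm)

variable (A) in
/-- The complex of cochains with values in `A`, in homogeneous form. -/
def selfComplexIso : cochainComplexNat A ≅ homComplex (𝟙 H) A :=
  HomologicalComplex.Hom.isoOfComponents (fun n => (selfEquiv A n).toAddCommGrpIso) (by
    rintro n _ rfl
    rw [homComplex_d, cochainComplexNat_d]
    ext f
    exact Subtype.ext (homogenize_barD f.1).symm)

end Homogeneous

variable [BraidedCategory C] {T : TopologicalCategory.{u, v, w} C} {D G G' H : C} [MonObj D]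
  [GrpObj G] [GrpObj G'] [GrpObj H] {A : T.RigidModule (D ⊗ H)}

/-! ### Functoriality of homogeneous cochains -/

section Pullback

variable {i : H ⟶ G} {i' : H ⟶ G'} (φ : G ⟶ G')
  (hφ : ∀ (h : T.El H) (g : T.El G), T.map φ (T.map i h * g) = T.map i' h * T.map φ g)

-- Multiplicativity of `φ` is not needed: faces only omit vertices, and the conditions involve the
-- vertices through equality and left translation by `H` alone. Hence `r` is admissible.
include hφ in
lemma IsHomogeneous.pullback {n : ℕ} {K : (ℕ → T.El D) → (ℕ → T.El G') → A.carrier}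
    (hK : IsHomogeneous i' A n K) : IsHomogeneous i A n (fun d s => K d (T.map φ ∘ s)) where
  congr hd hs := hK.congr hd fun k hk => congrArg _ (hs k hk)
  smul_left e d s := hK.smul_left e d _
  equivariant h d s := by
    rw [← hK.equivariant]
    exact congrArg _ (funext fun k => hφ h (s k))
  mem hd hs := hK.mem hd fun k => (hs k).map φ
  normalised hk hd hs := hK.normalised hk hd (congrArg (T.map φ) hs)

variable (A) in
/-- The morphism of complexes of homogeneous cochains induced by an equivariant morphism. -/
def homPullback : homComplex i' A ⟶ homComplex i A :=
  CochainComplex.ofHom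
    (fun n => AddCommGrpCat.ofHom
      (({toFun := fun K => ⟨fun d s => K.1 d (T.map φ ∘ s), K.2.pullback φ hφ⟩
         map_zero' := rfl
         map_add' := fun _ _ => rfl} : homCochains i' A n →+ homCochains i A n)))
    (fun n => by
      rw [homComplex_d, homComplex_d]
      ext K
      refine Subtype.ext (funext fun d => funext fun s => ?_)
      change ∑ a ∈ Finset.range (n + 2), (-1 : ℤ) ^ a • K.1 (contract a d) (T.map φ ∘ skip a s) =
        ∑ a ∈ Finset.range (n + 2), (-1 : ℤ) ^ a • K.1 (contract a d) (skip a (T.map φ ∘ s))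
      simp only [map_comp_skip])

end Pullback

/-! ### Equivariant endomorphisms are homotopic to the identity -/

section Homotopy

variable {i : H ⟶ G} (ρ : G ⟶ G)
  (hρ : ∀ (h : T.El H) (g : T.El G), T.map ρ (T.map i h * g) = T.map i h * T.map ρ g)

include hρ in
lemma IsHomogeneous.prism {n j : ℕ} (hj : j ≤ n)
    {K : (ℕ → T.El D) → (ℕ → T.El G) → A.carrier} (hK : IsHomogeneous i A (n + 1) K) :
    IsHomogeneous i A n (fun d s => K (insertOne j d) (HomogeneousBar.prism (T.map ρ) j s)) where
  congr {d d' s s'} hd hs := by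
    refine hK.congr (fun k hk => ?_) fun k hk => ?_
    · unfold insertOne
      split_ifs
      exacts [hd k (by omega), rfl, hd (k - 1) (by omega)]
    · unfold HomogeneousBar.prism
      split_ifs
      exacts [hs k (by omega), congrArg _ (hs (k - 1) (by omega))]
  smul_left e d s := by
    rw [← hK.smul_left]
    congr 1
    funext k
    rcases k with _ | k
    · simp [insertOne]
    · simp only [insertOne, Function.update_apply]
      split_ifs <;> first | rfl | omega | contradiction
  equivariant h d s := by
    rw [← hK.equivariant]
    congr 1
    funext k
    unfold HomogeneousBar.prism
    split_ifs
    exacts [rfl, hρ _ _]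
  mem hd hs := hK.mem (isMor_insertOne hd j) (isMor_prism hs ρ j)
  normalised {d s k} hk hd hs := by
    -- A degenerate edge at or after position `j` is moved up by one and mapped by `ρ`; an earlier
    -- one is untouched.
    rcases le_or_gt j k with h | h
    · refine hK.normalised (k := k + 1) (by omega) ?_ ?_
      · simpa [insertOne, show ¬ k + 1 + 1 ≤ j by omega, show ¬ k + 1 = j by omega] using hd
      · simp [HomogeneousBar.prism, show ¬ k + 1 ≤ j by omega, show ¬ k + 1 + 1 ≤ j by omega, hs]
    · refine hK.normalised (k := k) (by omega) ?_ ?_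
      · simpa [insertOne, show k + 1 ≤ j by omega] using hd
      · simpa [HomogeneousBar.prism, show k + 1 ≤ j by omega, show k ≤ j by omega] using hs

/-- The prism operator on functions of two sequences. -/
def prismSum (n : ℕ) (K : (ℕ → T.El D) → (ℕ → T.El G) → A.carrier) (d : ℕ → T.El D)
    (s : ℕ → T.El G) : A.carrier :=
  ∑ j ∈ Finset.range (n + 1), (-1 : ℤ) ^ j • K (insertOne j d) (HomogeneousBar.prism (T.map ρ) j s)

include hρ in
lemma IsHomogeneous.prismSum {n : ℕ} {K : (ℕ → T.El D) → (ℕ → T.El G) → A.carrier}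
    (hK : IsHomogeneous i A (n + 1) K) : IsHomogeneous i A n (prismSum ρ n K) := by
  have h : ∑ j ∈ Finset.range (n + 1), (-1 : ℤ) ^ j •
      (fun d s => K (insertOne j d) (HomogeneousBar.prism (T.map ρ) j s)) ∈ homCochains i A n :=
    sum_mem fun j hj =>
      zsmul_mem (hK.prism ρ hρ (Nat.lt_succ_iff.mp (Finset.mem_range.mp hj))) _
  have e : TopologicalCategory.prismSum ρ n K = ∑ j ∈ Finset.range (n + 1), (-1 : ℤ) ^ j •
      (fun d s => K (insertOne j d) (HomogeneousBar.prism (T.map ρ) j s)) := by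
    funext d s
    simp [TopologicalCategory.prismSum, Finset.sum_apply]
  rw [e]
  exact h

variable (A) in
/-- The prism operator on homogeneous cochains. -/
def homPrism (n : ℕ) : homCochains i A (n + 1) →+ homCochains i A n where
  toFun K := ⟨prismSum ρ n K.1, K.2.prismSum ρ hρ⟩
  map_zero' := by
    refine Subtype.ext (funext fun d => funext fun s => ?_)
    simp [prismSum]
  map_add' K L := by
    refine Subtype.ext (funext fun d => funext fun s => ?_)
    simp [prismSum, Finset.sum_add_distrib]

/-- The prism identity, with the term `∂ ∘ s` written out so as to make sense in degree `0`. -/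
lemma prismSum_coboundary_add {n : ℕ} {K : (ℕ → T.El D) → (ℕ → T.El G) → A.carrier}
    (hK : IsHomogeneous i A n K) (d : ℕ → T.El D) (s : ℕ → T.El G) :
    prismSum ρ n (coboundary n K) d s +
      ∑ a ∈ Finset.range (n + 1), (-1 : ℤ) ^ a • ∑ j ∈ Finset.range n, (-1 : ℤ) ^ j •
        K (insertOne j (contract a d)) (HomogeneousBar.prism (T.map ρ) j (skip a s)) =
    K d (T.map ρ ∘ s) - K d s := by
  have h := sum_simplicial_homotopy n
    (fun a j => K (contract a (insertOne j d)) (skip a (HomogeneousBar.prism (T.map ρ) j s)))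
    (fun a j => K (insertOne j (contract a d)) (HomogeneousBar.prism (T.map ρ) j (skip a s)))
    (fun a j haj => by rw [contract_insertOne_of_lt d haj, skip_prism_of_lt (T.map ρ) s haj])
    (fun a j haj => by rw [contract_insertOne_of_gt d haj, skip_prism_of_gt (T.map ρ) s haj])
    (fun j => by rw [contract_insertOne_succ, skip_prism_succ])
  refine h.trans ?_
  simp only [contract_insertOne_zero, skip_prism_zero]
  -- The last face of the last prism agrees with `(d, s)` only at the indices up to `n`, which is
  -- all that `K` sees.
  congr 1
  refine hK.congr (fun k hk => ?_) fun k hk => ?_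
  · simp [contract, insertOne, show k < n + 1 by omega, hk]
  · simp [skip, HomogeneousBar.prism, show k < n + 1 by omega, hk]

variable (A) in
lemma homPullback_sub_id : homPullback A ρ hρ - 𝟙 (homComplex i A) =
    Homotopy.nullHomotopicMap' (fun a b hab => by
      obtain rfl : b + 1 = a := hab
      exact AddCommGrpCat.ofHom (homPrism A ρ hρ b)) := by
  ext n : 1
  -- In degree `0` only the term `prism ∘ ∂` exists; in the prism identity the other sum is then
  -- over an empty range.
  rcases n with _ | n
  · rw [Homotopy.nullHomotopicMap'_f_of_not_rel_right (k₁ := 0) (k₀ := 1) rfl (by simp),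
      homComplex_d]
    ext K
    refine Subtype.ext (funext fun d => funext fun s => ?_)
    have h := prismSum_coboundary_add ρ K.2 d s
    simp only [Finset.range_zero, Finset.sum_empty, smul_zero, Finset.sum_const_zero,
      add_zero] at h
    exact h.symm
  · rw [Homotopy.nullHomotopicMap'_f (k₂ := n) (k₁ := n + 1) (k₀ := n + 2) rfl rfl,
      homComplex_d, homComplex_d]
    ext K
    exact Subtype.ext (funext fun d => funext fun s =>
      (prismSum_coboundary_add ρ K.2 d s).symm)

variable (A) in
/-- An equivariant endomorphism of `G` induces a map homotopic to the identity. -/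
def homPullbackHomotopy : Homotopy (homPullback A ρ hρ) (𝟙 (homComplex i A)) :=
  Homotopy.equivSubZero.symm
    ((Homotopy.ofEq (homPullback_sub_id A ρ hρ)).trans (Homotopy.nullHomotopy' _))

end Homotopy

/-! ### The homotopy equivalence and its image in the derived category. -/

variable (A) in
/-- If `G` admits an equivariant morphism to `H`, then homogeneous cochains on `G` and on `H` are
homotopy equivalent. -/
def homComplexHomotopyEquiv (i : H ⟶ G) [IsMonHom i] (r : G ⟶ H)
    (hr : ∀ (h : T.El H) (g : T.El G), T.map r (T.map i h * g) = h * T.map r g) :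
    HomotopyEquiv (homComplex i A) (homComplex (𝟙 H) A) where
  hom := homPullback A i (fun h g => by rw [map_id, map_hom_mul])
  inv := homPullback A r (fun h g => by rw [map_id, hr])
  homotopyHomInvId :=
    -- Pullback is contravariant, so restricting along `i` and then pulling back along `r` is
    -- pullback along the equivariant endomorphism `r ≫ i` of `G`.
    (Homotopy.ofEq (by
      ext n K
      refine Subtype.ext (funext fun d => funext fun s => ?_)
      exact congrArg (K.1 d) (funext fun k => (T.map_comp r i (s k)).symm))).trans
      (homPullbackHomotopy A (r ≫ i) (fun h g => by
        rw [map_comp, map_comp, hr, map_hom_mul]))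
  homotopyInvHomId :=
    (Homotopy.ofEq (by
      ext n K
      refine Subtype.ext (funext fun d => funext fun s => ?_)
      exact congrArg (K.1 d) (funext fun k => (T.map_comp i r (s k)).symm))).trans
      (homPullbackHomotopy A (i ≫ r) (fun h g => by
        simp only [map_comp, map_id, map_hom_mul, hr]))

/-- A homotopy equivalence of complexes in nonnegative degrees gives an isomorphism in the derived
category. -/
lemma nonempty_Q_extend_iso [HasDerivedCategory.{t} AddCommGrpCat.{w}]
    {K L : CochainComplex AddCommGrpCat.{w} ℕ} (e : HomotopyEquiv K L) :
    Nonempty (DerivedCategory.Q.obj (K.extend ComplexShape.embeddingUpNat) ≅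
      DerivedCategory.Q.obj (L.extend ComplexShape.embeddingUpNat)) := by
  have : QuasiIso e.hom := homotopyEquivalences_le_quasiIso _ _ _ ⟨e, rfl⟩
  have : QuasiIso (HomologicalComplex.extendMap e.hom ComplexShape.embeddingUpNat) :=
    (HomologicalComplex.quasiIso_extendMap_iff _ _).mpr this
  exact ⟨asIso (DerivedCategory.Q.map
    (HomologicalComplex.extendMap e.hom ComplexShape.embeddingUpNat))⟩

end TopologicalCategory

end

theorem theorem12p1 {C : Type u} [Category.{v} C] [HasFiniteLimits C]
    [CartesianMonoidalCategory C] [BraidedCategory C] (T : TopologicalCategory.{u, v, w} C)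
    [HasDerivedCategory.{t} AddCommGrpCat.{w}]
    -- `G` is a group object, `H` a subgroup, `D` a discrete monoid object
    (G H D : C) [GrpObj G] [GrpObj H] [MonObj D] (hD : T.IsDiscrete D)
    (i : H ⟶ G) [IsMonHom i] [Mono i]
    -- a morphism `r : G ⟶ H` with `r 1 = 1` and `r (h g) = h r(g)`
    (r : G ⟶ H) (hr_one : T.map r 1 = 1)
    (hr_mul : ∀ (h : T.El H) (g : T.El G), T.map r (T.map i h * g) = h * T.map r g)
    (A : T.RigidModule (D ⊗ H)) (hA : A.rig.IsPliant D) :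
    Nonempty
      (DerivedCategory.Q.obj (TopologicalCategory.cochainComplex (TopologicalCategory.ind i A)) ≅
        DerivedCategory.Q.obj (TopologicalCategory.cochainComplex A)) :=
  TopologicalCategory.nonempty_Q_extend_iso
    (((HomotopyEquiv.ofIso (TopologicalCategory.indComplexIso i A)).trans
      (TopologicalCategory.homComplexHomotopyEquiv A i r hr_mul)).trans
      (HomotopyEquiv.ofIso (TopologicalCategory.selfComplexIso A).symm))
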